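/- Let $d \ge 1$ be an integer, let $G=(V,E)$ be a finite simple graph, and let $u,v\in V$ be a pair of vertices; $G+uv$ denotes $G$ with the edge $uv$ added (so $G+uv=G$ if $uv\in E$). For a configuration $p:V\to\mathbb{C}^d$ put $m_{xy}(p)=\sum_{i=1}^d (p(x)_i-p(y)_i)^2$ for $x,y\in V$ and $m_{d,G}(p)=(m_{xy}(p))_{xy\in E}\in\mathbb{C}^E$. Call $p$ generic if its $d|V|$ coordinates satisfy no nonzero polynomial with rational coefficients, and call $(G,p)$ and $(G,q)$ equivalent if $m_{d,G}(p)=m_{d,G}(q)$. For $\mathbb{K}\in\{\mathbb{C},\mathbb{R}\}$, the pair $\{u,v\}$ is globally linked in $G$ in $\mathbb{K}^d$ if $m_{uv}(p)=m_{uv}(q)$ whenever $p,q:V\to\mathbb{K}^d$, $p$ is generic, and $(G,p)$ and $(G,q)$ are equivalent. Let $M_{d,G}\subseteq\mathbb{C}^E$ be the Zariski closure of the image of $m_{d,G}$, and let $r_d(G)$ be the rank of its algebraic matroid, that is, the largest size of a set $E_0\subseteq E$ such that the projection of $M_{d,G}$ to $\mathbb{C}^{E_0}$ is Zariski dense. The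 pair $\{u,v\}$ is $\mathcal{R}_d$-linked in $G$ if $r_d(G+uv)=r_d(G)$. A stress of $(G,p)$ is a vector $\omega\in\mathbb{C}^E$ with $\sum_{w:\,xw\in E}\omega(xw)\,(p(w)-p(x))=0$ for every $x\in V$. Let $K_1(G,p)$ be the linear space of all $q:V\to\mathbb{C}$ such that every stress of $(G,p)$ is also a stress of the one-dimensional framework $(G,q)$. The shared stress nullity of $G$ in $d$ dimensions is $\dim_{\mathbb{C}} K_1(G,p)$ for generic $p:V\to\mathbb{C}^d$ (this number is the same for every generic $p$). The pair $\{u,v\}$ is $d$-stress-linked in $G$ if it is $\mathcal{R}_d$-linked in $G$ and the shared stress nullities of $G+uv$ and of $G$ in $d$ dimensions are equal. Theorem. If $\{u,v\}$ is $d$-stress-linked in $G$, then $\{u,v\}$ is globally linked in $G$ in $\mathbb{C}^d$, and hence also in $\mathbb{R}^d$. -/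

import Mathlib

namespace StressLinked

section Configurations

variable {V : Type*} {K : Type*} [Field K] {d : ℕ}

/-- The squared-distance map `m_{uv}(p) = ∑ i, (p(u)_i - p(v)_i)^2`. Over `ℂ` this is the bilinear
(not the Hermitian) expression. -/
def sqDist (p : V → Fin d → K) (u v : V) : K :=
  ∑ i, (p u i - p v i) ^ 2

theorem sqDist_comm (p : V → Fin d → K) (u v : V) : sqDist p u v = sqDist p v u :=
  Finset.sum_congr rfl fun _ _ => by ring

/-- The edge measurement map `m_{d,G}`, sending a configuration to its vector of squared edge
lengths. -/
def measurementMap (G : SimpleGraph V) (p : V → Fin d → K) : G.edgeSet → K :=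
  fun e => Sym2.lift ⟨sqDist p, sqDist_comm p⟩ e.1

/-- The realizations `(G,p)` and `(G,q)` are equivalent. -/
def Equivalent (G : SimpleGraph V) (p q : V → Fin d → K) : Prop :=
  measurementMap G p = measurementMap G q

/-- A configuration is generic if its `|V| d` coordinates satisfy no nonzero polynomial with
rational coefficients. -/
def IsGeneric [CharZero K] (p : V → Fin d → K) : Prop :=
  AlgebraicIndependent ℚ fun x : V × Fin d => p x.1 x.2

/-- `{u,v}` is globally linked in `G` in `K^d` (used for `K = ℂ` and `K = ℝ`). -/
def GloballyLinked (K : Type*) [Field K] [CharZero K] (d : ℕ) (G : SimpleGraph V) (u v : V) :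
    Prop :=
  ∀ p q : V → Fin d → K, IsGeneric p → Equivalent G p q → sqDist p u v = sqDist q u v

end Configurations

section RigidityMatroid

/-- The Zariski closure of a subset of the affine space `ℂ^σ`: the set of common zeroes of all
polynomials vanishing on `X`. -/
def zariskiClosure {σ : Type*} (X : Set (σ → ℂ)) : Set (σ → ℂ) :=
  MvPolynomial.zeroLocus ℂ (MvPolynomial.vanishingIdeal ℂ X)

/-- Independence in the algebraic matroid of `X ⊆ ℂ^E`: the projection of `X` to `ℂ^{E₀}` is
Zariski dense. -/
def AlgMatroidIndep {E : Type*} (X : Set (E → ℂ)) (E₀ : Set E) : Prop :=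
  zariskiClosure ((fun (x : E → ℂ) (e : E₀) => x e) '' X) = Set.univ

/-- The rank of the algebraic matroid of `X ⊆ ℂ^E` (for `E` finite): the largest size of an
independent set. -/
noncomputable def algMatroidRank {E : Type*} (X : Set (E → ℂ)) : ℕ :=
  sSup {k | ∃ E₀ : Set E, AlgMatroidIndep X E₀ ∧ E₀.ncard = k}

variable {V : Type*}

/-- The `d`-dimensional measurement variety `M_{d,G}`. -/
def measurementVariety (d : ℕ) (G : SimpleGraph V) : Set (G.edgeSet → ℂ) :=
  zariskiClosure (Set.range fun p : V → Fin d → ℂ => measurementMap G p)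

/-- The rank `r_d(G)` of the `d`-dimensional generic rigidity matroid of `G`. -/
noncomputable def rigidityRank (d : ℕ) (G : SimpleGraph V) : ℕ :=
  algMatroidRank (measurementVariety d G)

/-- The graph `G + uv`. -/
def addEdge (G : SimpleGraph V) (u v : V) : SimpleGraph V :=
  G ⊔ SimpleGraph.edge u v

/-- `{u,v}` is `R_d`-linked in `G`. -/
def RigidityLinked (d : ℕ) (G : SimpleGraph V) (u v : V) : Prop :=
  rigidityRank d (addEdge G u v) = rigidityRank d G

end RigidityMatroid

section Stresses

variable {V : Type*} [Fintype V]

open Classical in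
/-- The space `S(G,p)` of equilibrium stresses: those `ω ∈ ℂ^E` with
`∑_{w : vw ∈ E} ω(vw) (p(w) - p(v)) = 0` at every vertex `v`. The configuration may take values in
any complex vector space `W`; it is used for `W = ℂ^d` and, for one-dimensional configurations,
`W = ℂ`. -/
def stressSpace {W : Type*} [AddCommGroup W] [Module ℂ W] (G : SimpleGraph V) (p : V → W) :
    Submodule ℂ (G.edgeSet → ℂ) where
  carrier := {ω | ∀ v, ∑ w, (if h : G.Adj v w then ω ⟨s(v, w), h⟩ • (p w - p v) else 0) = 0}
  zero_mem' := by simp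
  add_mem' := by
    intro a b ha hb v
    have := congrArg₂ (· + ·) (ha v) (hb v)
    simp only [← Finset.sum_add_distrib, add_zero] at this
    refine Eq.trans ?_ this
    refine Finset.sum_congr rfl fun w _ => ?_
    split_ifs <;> simp [add_smul]
  smul_mem' := by
    intro c a ha v
    have := congrArg (c • ·) (ha v)
    simp only [Finset.smul_sum, smul_zero] at this
    refine Eq.trans ?_ this
    refine Finset.sum_congr rfl fun w _ => ?_
    split_ifs <;> simp [mul_smul]

/-- The one-dimensional shared stress kernel `K_1(G,p)`: all one-dimensional configurations that
satisfy every stress of `(G,p)`. -/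
def sharedStressKernel {d : ℕ} (G : SimpleGraph V) (p : V → Fin d → ℂ) :
    Submodule ℂ (V → ℂ) where
  carrier := {q | stressSpace G p ≤ stressSpace G q}
  zero_mem' := by
    intro ω _ v
    simp
  add_mem' := by
    intro a b ha hb ω hω v
    have := congrArg₂ (· + ·) (ha hω v) (hb hω v)
    simp only [← Finset.sum_add_distrib, add_zero] at this
    refine Eq.trans ?_ this
    refine Finset.sum_congr rfl fun w _ => ?_
    split_ifs
    · simp only [Pi.add_apply, smul_eq_mul]; ring
    · simp
  smul_mem' := by
    intro c a ha ω hω v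
    have := congrArg (c • ·) (ha hω v)
    simp only [Finset.smul_sum, smul_zero] at this
    refine Eq.trans ?_ this
    refine Finset.sum_congr rfl fun w _ => ?_
    split_ifs
    · simp only [Pi.smul_apply, smul_eq_mul]; ring
    · simp

/-- The shared stress nullity of `G` in `d` dimensions: the dimension of `K_1(G,p)` for generic
`(G,p)` in `ℂ^d`. Generic configurations exist and the dimension is the same for all of them, so
the infimum is over a one-element set. -/
noncomputable def sharedStressNullity (d : ℕ) (G : SimpleGraph V) : ℕ :=
  sInf {k | ∃ p : V → Fin d → ℂ, IsGeneric p ∧ Module.finrank ℂ (sharedStressKernel G p) = k}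

/-- `{u,v}` is `d`-stress-linked in `G`. -/
def IsStressLinked (d : ℕ) (G : SimpleGraph V) (u v : V) : Prop :=
  RigidityLinked d G u v ∧ sharedStressNullity d (addEdge G u v) = sharedStressNullity d G

end Stresses

end StressLinked

/-!
Let `p` be generic and `(G, q)` equivalent to `(G, p)`. The squared edge lengths of `p` satisfy
only those polynomial relations over `ℚ` that hold identically in the configuration. Hence for
every velocity `q'`, taking the lengths of `p` to those of `q + ε q'` in the dual numbers gives a
well-defined homomorphism of `ℚ`-algebras. It extends to the whole field because a field extension
in characteristic zero is formally smooth, and the resulting derivation `D` satisfies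
`⟨p x - p y, D (p x) - D (p y)⟩ = ⟨q x - q y, q' x - q' y⟩` on every edge. So the range of the
rigidity map at `q` lies in the range at `p`; stresses are the functionals annihilating this range,
so every stress of `(G, p)` is a stress of `(G, q)`, and each coordinate of `q` lies in
`K₁(G, p) = K₁(G + uv, p)`. Hence stresses of `(G + uv, p)` are stresses of `(G + uv, q)` as well.

Since `{u, v}` is `R_d`-linked, the length of `uv` is algebraic over the lengths in `G`, so a
velocity preserving the latter to first order preserves the former, and by duality `(G + uv, p)`
has a stress `ω` with `ω(uv) ≠ 0`. As a stress of both frameworks, `ω` is orthogonal to both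
vectors of squared lengths; these agree on `G`, so they agree on `uv`.

The generic value of `dim K₁` is well defined because any two generic configurations are conjugate
under an automorphism of `ℂ`.
-/

namespace StressLinked

open MvPolynomial TrivSqZeroExt

section Derivations

theorem formallySmooth_of_charZero (K L : Type*) [Field K] [CharZero K] [Field L] [Algebra K L] :
    Algebra.FormallySmooth K L := by
  obtain ⟨s, hs⟩ := exists_isTranscendenceBasis K L
  have : Algebra.IsAlgebraic (IntermediateField.adjoin K (Set.range ((↑) : s → L))) L :=
    hs.isAlgebraic_field
  exact .of_algebraicIndependent_of_isSeparable hs.1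

theorem formallySmooth_of_faithfulSMul (A L : Type*) [CommRing A] [Field L] [CharZero L]
    [Algebra A L] [FaithfulSMul A L] : Algebra.FormallySmooth A L := by
  have : IsDomain A := (FaithfulSMul.algebraMap_injective A L).isDomain
  let := FractionRing.liftAlgebra A L
  have : CharZero (FractionRing A) :=
    ((algebraMap (FractionRing A) L).charZero_iff (RingHom.injective _)).2 inferInstance
  have := formallySmooth_of_charZero (FractionRing A) L
  have : Algebra.FormallySmooth A (FractionRing A) := .of_isLocalization (nonZeroDivisors A)
  exact .comp A (FractionRing A) L

theorem exists_section_extending {R A B L : Type*} [CommRing R] [CommRing A] [CommRing B]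
    [Field L] [CharZero L] [Algebra R A] [Algebra R B] [Algebra R L]
    {a : A →ₐ[R] L} (ha : Function.Injective a) {π : B →ₐ[R] L} (hπ : Function.Surjective π)
    (hker : IsNilpotent (RingHom.ker π)) {ψ : A →ₐ[R] B} (hψ : π.comp ψ = a) :
    ∃ Φ : L →ₐ[R] B, π.comp Φ = AlgHom.id R L ∧ Φ.comp a = ψ := by
  let := a.toAlgebra
  let := ψ.toAlgebra
  have : IsScalarTower R A L := .of_algHom a
  have : IsScalarTower R A B := .of_algHom ψ
  have : FaithfulSMul A L := (faithfulSMul_iff_algebraMap_injective A L).2 ha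
  have := formallySmooth_of_faithfulSMul A L
  let π' : B →ₐ[A] L := { π with commutes' := AlgHom.congr_fun hψ }
  let Φ := Algebra.FormallySmooth.liftOfSurjective (AlgHom.id A L) π' hπ hker
  refine ⟨Φ.restrictScalars R, AlgHom.ext fun z => ?_, AlgHom.ext Φ.commutes⟩
  exact Algebra.FormallySmooth.liftOfSurjective_apply (AlgHom.id A L) π' hπ hker z

theorem exists_derivation_fst_eq_snd {R L : Type*} [CommRing R] [Field L] [CharZero L]
    [Algebra R L] {A : Subalgebra R (DualNumber L)} (hA : ∀ x ∈ A, x.fst = 0 → x = 0) :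
    ∃ D : Derivation R L L, ∀ x ∈ A, D x.fst = x.snd := by
  let π : DualNumber L →ₐ[R] L := (fstHom L L L).restrictScalars R
  have hπ : Function.Injective (π.comp A.val) :=
    (injective_iff_map_eq_zero _).2 fun x hx => Subtype.ext (hA x x.2 hx)
  have hker : IsNilpotent (RingHom.ker π) := ⟨2, kerIdeal_sq L L⟩
  obtain ⟨Φ, hΦ, hΦA⟩ := exists_section_extending hπ fst_surjective hker (ψ := A.val) rfl
  have hfst (z : L) : (Φ z).fst = z := AlgHom.congr_fun hΦ z
  have hA' (x : A) : Φ (x : DualNumber L).fst = x := AlgHom.congr_fun hΦA x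
  refine ⟨.mk' ((sndHom L L).restrictScalars R ∘ₗ Φ.toLinearMap) fun w z => ?_, fun x hx => ?_⟩
  · simp [hfst, mul_comm]
  · simp [hA' ⟨x, hx⟩]

theorem exists_derivation_of_aeval_fst_eq_zero {R σ L : Type*} [CommRing R] [Field L] [CharZero L]
    [Algebra R L] {Y : σ → DualNumber L}
    (hY : ∀ f : MvPolynomial σ R, aeval (fun i => (Y i).fst) f = 0 → aeval Y f = 0) :
    ∃ D : Derivation R L L, ∀ i, D (Y i).fst = (Y i).snd := by
  have hfst (f : MvPolynomial σ R) : (aeval Y f).fst = aeval (fun i => (Y i).fst) f :=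
    comp_aeval_apply Y (fstHom R L L) f
  obtain ⟨D, hD⟩ := exists_derivation_fst_eq_snd (A := (aeval (R := R) Y).range) <| by
    rintro _ ⟨f, rfl⟩ hf
    exact hY f ((hfst f).symm.trans hf)
  exact ⟨D, fun i => hD (Y i) ⟨X i, aeval_X Y i⟩⟩

theorem derivation_eq_zero_of_isAlgebraic {F L : Type*} [Field F] [CharZero F] [Field L]
    [Algebra F L] (D : Derivation F L L) {s : Set L} (hs : ∀ x ∈ s, D x = 0) {t : L}
    (ht : IsAlgebraic (Algebra.adjoin F s) t) : D t = 0 := by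
  let k := IntermediateField.adjoin F s
  have hk (x : k) : D x = 0 := by
    refine IntermediateField.adjoin_induction F (p := fun x _ => D x = 0) hs D.map_algebraMap
      (fun x y _ _ hx hy => by simp [hx, hy]) (fun x _ hx => by simp [D.leibniz_inv, hx])
      (fun x y _ _ hx hy => by simp [hx, hy]) x.2
  let Dk : Derivation k L L := Derivation.mk'
    { D.toLinearMap with map_smul' := fun c x => by simp [Algebra.smul_def, hk] } D.leibniz
  have htk : IsIntegral k t := (IntermediateField.isAlgebraic_adjoin_iff.2 ht).isIntegral
  have hsep : (minpoly k t).Separable := (minpoly.irreducible htk).separable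
  have h0 := Dk.map_aeval (minpoly k t) t
  rw [minpoly.aeval, map_zero, eq_comm, smul_eq_zero] at h0
  exact h0.resolve_left (hsep.aeval_derivative_ne_zero (minpoly.aeval k t))

end Derivations

section EdgeForm

variable {V ι R S : Type*} [Fintype ι] [CommRing R] [CommRing S]

/-- The polarization of the squared edge length: `⟨p x - p y, q x - q y⟩` on the edge `xy`. So
`edgeForm p p` collects the squared lengths of `p`, and `2 * edgeForm p p'` is their first-order
change when `p` moves with velocity `p'`. -/
def edgeForm (p q : V → ι → R) : Sym2 V → R :=
  Sym2.lift ⟨fun x y => (p x - p y) ⬝ᵥ (q x - q y), fun x y => by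
    simp only [← neg_sub (p y), ← neg_sub (q y), neg_dotProduct_neg]⟩

@[simp]
theorem edgeForm_mk (p q : V → ι → R) (x y : V) :
    edgeForm p q s(x, y) = (p x - p y) ⬝ᵥ (q x - q y) :=
  rfl

theorem map_edgeForm (φ : R →+* S) (p q : V → ι → R) (e : Sym2 V) :
    φ (edgeForm p q e) = edgeForm (fun x i => φ (p x i)) (fun x i => φ (q x i)) e := by
  induction e with
  | _ x y => simp [dotProduct]

theorem derivation_edgeForm_self [Algebra R S] (D : Derivation R S S) (p : V → ι → S) (e : Sym2 V) :
    D (edgeForm p p e) = 2 * edgeForm p (fun x i => D (p x i)) e := by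
  induction e with
  | _ x y => simp [dotProduct, two_mul, Finset.sum_add_distrib]

theorem fst_edgeForm_self (P : V → ι → DualNumber R) (e : Sym2 V) :
    (edgeForm P P e).fst = edgeForm (fun x i => (P x i).fst) (fun x i => (P x i).fst) e :=
  map_edgeForm (fstHom R R R).toRingHom P P e

theorem snd_edgeForm_self (P : V → ι → DualNumber R) (e : Sym2 V) :
    (edgeForm P P e).snd = 2 * edgeForm (fun x i => (P x i).fst) (fun x i => (P x i).snd) e := by
  induction e with
  | _ x y => simp [dotProduct, two_mul, snd_sum, mul_comm, Finset.sum_add_distrib]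

variable (R) in
/-- The squared length of an edge as a polynomial in the coordinates of the configuration. -/
noncomputable def lengthPolynomial (e : Sym2 V) : MvPolynomial (V × ι) R :=
  edgeForm (fun x i => X (x, i)) (fun x i => X (x, i)) e

theorem aeval_lengthPolynomial [Algebra R S] (p : V → ι → S) (e : Sym2 V) :
    aeval (fun z : V × ι => p z.1 z.2) (lengthPolynomial R e) = edgeForm p p e := by
  simpa [lengthPolynomial] using map_edgeForm (aeval (R := R) fun z : V × ι => p z.1 z.2).toRingHom
    (fun x i => X (x, i)) (fun x i => X (x, i)) e

theorem map_lengthPolynomial (φ : R →+* S) (e : Sym2 V) :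
    MvPolynomial.map φ (lengthPolynomial (ι := ι) R e) = lengthPolynomial S e := by
  simp [lengthPolynomial, map_edgeForm]

theorem aeval_aeval_lengthPolynomial [Algebra R S] {σ : Type*} (p : V → ι → S) (e : σ → Sym2 V)
    (f : MvPolynomial σ R) :
    aeval (fun z : V × ι => p z.1 z.2) (aeval (fun i => lengthPolynomial R (e i)) f) =
      aeval (fun i => edgeForm p p (e i)) f := by
  simp only [← AlgHom.comp_apply, comp_aeval, aeval_lengthPolynomial]

/-- The rigidity map of the framework `(G, p)`, sending a velocity `p'` to half the first-order
change of the squared edge lengths. -/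
def rigidityMap (G : SimpleGraph V) (p : V → ι → R) : (V → ι → R) →ₗ[R] (G.edgeSet → R) where
  toFun p' e := edgeForm p p' e
  map_add' a b := by
    ext ⟨e, -⟩
    induction e with
    | _ x y => simp [add_sub_add_comm]
  map_smul' c a := by
    ext ⟨e, -⟩
    induction e with
    | _ x y => simp [← smul_sub]

@[simp]
theorem rigidityMap_apply (G : SimpleGraph V) (p p' : V → ι → R) (e : G.edgeSet) :
    rigidityMap G p p' e = edgeForm p p' e :=
  rfl

theorem sqDist_eq_edgeForm {K : Type*} [Field K] {d : ℕ} (p : V → Fin d → K) (x y : V) :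
    sqDist p x y = edgeForm p p s(x, y) := by
  simp only [sqDist, edgeForm_mk, dotProduct, Pi.sub_apply, sq]

theorem measurementMap_eq_rigidityMap {K : Type*} [Field K] {d : ℕ} (G : SimpleGraph V)
    (p : V → Fin d → K) : measurementMap G p = rigidityMap G p p := by
  ext ⟨e, _⟩
  induction e with
  | _ x y => exact sqDist_eq_edgeForm p x y

theorem equivalent_iff {K : Type*} [Field K] {d : ℕ} {G : SimpleGraph V} {p q : V → Fin d → K} :
    Equivalent G p q ↔ ∀ e ∈ G.edgeSet, edgeForm p p e = edgeForm q q e := by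
  rw [Equivalent, measurementMap_eq_rigidityMap, measurementMap_eq_rigidityMap]
  simp only [funext_iff, Subtype.forall, rigidityMap_apply]

end EdgeForm

section Deformations

variable {V K : Type*} [Field K] [CharZero K] {d : ℕ} {p q : V → Fin d → K}

theorem IsGeneric.aeval_edgeForm_eq_zero {σ S : Type*} [CommRing S] [Algebra ℚ S]
    (hp : IsGeneric p) {e : σ → Sym2 V} {f : MvPolynomial σ ℚ}
    (hf : aeval (fun i => edgeForm p p (e i)) f = 0) (r : V → Fin d → S) :
    aeval (fun i => edgeForm r r (e i)) f = 0 := by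
  rw [← aeval_aeval_lengthPolynomial] at hf ⊢
  rw [hp.eq_zero_of_aeval_eq_zero _ hf, map_zero]

theorem IsGeneric.range_rigidityMap_le {G : SimpleGraph V} (hp : IsGeneric p)
    (hpq : Equivalent G p q) :
    LinearMap.range (rigidityMap G q) ≤ LinearMap.range (rigidityMap G p) := by
  rintro _ ⟨q', rfl⟩
  let Q : V → Fin d → DualNumber K := fun x i => inl (q x i) + inr (q' x i)
  have hlength (e : G.edgeSet) : (edgeForm Q Q e).fst = edgeForm p p e := by
    simpa [fst_edgeForm_self, Q] using (equivalent_iff.1 hpq e e.2).symm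
  obtain ⟨D, hD⟩ := exists_derivation_of_aeval_fst_eq_zero (R := ℚ)
    (Y := fun e : G.edgeSet => edgeForm Q Q e) fun f hf =>
      hp.aeval_edgeForm_eq_zero (by simpa only [hlength] using hf) Q
  refine ⟨fun x i => D (p x i), funext fun e => mul_left_cancel₀ (two_ne_zero' K) ?_⟩
  have h := hD e
  rw [hlength, derivation_edgeForm_self, snd_edgeForm_self] at h
  simpa [Q] using h

theorem IsGeneric.exists_derivation (hp : IsGeneric p) (p' : V → Fin d → K) :
    ∃ D : Derivation ℚ K K, ∀ x i, D (p x i) = p' x i := by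
  obtain ⟨D, hD⟩ := exists_derivation_of_aeval_fst_eq_zero (R := ℚ)
    (Y := fun z : V × Fin d => (inl (p z.1 z.2) + inr (p' z.1 z.2) : DualNumber K)) fun f hf => by
      rw [hp.eq_zero_of_aeval_eq_zero f (by simpa using hf), map_zero]
  exact ⟨D, fun x i => by simpa using hD (x, i)⟩

theorem IsGeneric.edgeForm_eq_zero_of_isAlgebraic (hp : IsGeneric p) {s : Set (Sym2 V)}
    {e : Sym2 V} (he : IsAlgebraic (Algebra.adjoin ℚ (edgeForm p p '' s)) (edgeForm p p e))
    {p' : V → Fin d → K} (hp' : ∀ a ∈ s, edgeForm p p' a = 0) : edgeForm p p' e = 0 := by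
  obtain ⟨D, hD⟩ := hp.exists_derivation p'
  have hlength (a : Sym2 V) : D (edgeForm p p a) = 2 * edgeForm p p' a := by
    simp only [derivation_edgeForm_self, hD]
  have h := derivation_eq_zero_of_isAlgebraic D (s := edgeForm p p '' s)
    (by rintro _ ⟨a, ha, rfl⟩; rw [hlength, hp' a ha, mul_zero]) he
  rw [hlength] at h
  exact (mul_eq_zero.1 h).resolve_left two_ne_zero

end Deformations

section Stresses

variable {V R S W : Type*} [Fintype V] [CommRing R] [CommRing S] [AddCommGroup W] [Module R W]
  {G H : SimpleGraph V}

open Classical in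
/-- The resultant at `x` of the forces exerted by the edge weights `ω` on the framework `(G, p)`:
`ω` is a stress exactly when it vanishes at every vertex. Configurations take values in any
module, so the coordinates of a framework in `ℂ^d` are covered too. -/
noncomputable def netForce (G : SimpleGraph V) (p : V → W) (ω : G.edgeSet → R) (x : V) : W :=
  ∑ y, if h : G.Adj x y then ω ⟨s(x, y), h⟩ • (p y - p x) else 0

theorem netForce_apply {ι : Type*} (p : V → ι → R) (ω : G.edgeSet → R) (x : V) (i : ι) :
    netForce G p ω x i = netForce G (fun y => p y i) ω x := by
  simp only [netForce, Finset.sum_apply]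
  refine Finset.sum_congr rfl fun y _ => ?_
  split_ifs <;> rfl

theorem map_netForce (φ : R →+* S) (q : V → R) (ω : G.edgeSet → R) (x : V) :
    φ (netForce G q ω x) = netForce G (φ ∘ q) (φ ∘ ω) x := by
  simp only [netForce, map_sum, apply_dite φ, smul_eq_mul, map_mul, map_sub, map_zero,
    Function.comp_apply]

theorem netForce_extend (hGH : G ≤ H) (p : V → W) (ω : G.edgeSet → R) (x : V) :
    netForce H p (Function.extend (Set.inclusion (SimpleGraph.edgeSet_mono hGH)) ω 0) x =
      netForce G p ω x := by
  refine Finset.sum_congr rfl fun y _ => ?_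
  by_cases hG : G.Adj x y
  · have := (Set.inclusion_injective (SimpleGraph.edgeSet_mono hGH)).extend_apply ω 0 ⟨s(x, y), hG⟩
    simp only [hG, hGH hG, dif_pos, ← this]
  · by_cases hH : H.Adj x y
    · rw [dif_pos hH, dif_neg hG, Function.extend_apply', Pi.zero_apply, zero_smul]
      rintro ⟨⟨e, he⟩, heq⟩
      cases heq
      exact hG he
    · simp only [hG, hH, dif_neg, not_false_iff]

open Classical in
theorem sum_dart {M : Type*} [AddCommMonoid M] (f : G.Dart → M) :
    ∑ a, f a = ∑ x, ∑ y, if h : G.Adj x y then f ⟨(x, y), h⟩ else 0 := by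
  rw [← Fintype.sum_prod_type' (f := fun x y => if h : G.Adj x y then f ⟨(x, y), h⟩ else 0)]
  refine Finset.sum_of_injOn SimpleGraph.Dart.toProd
    (SimpleGraph.Dart.toProd_injective.injOn) (by simp) (fun z _ hz => dif_neg fun h => ?_)
    fun a _ => by rw [dif_pos a.adj]
  exact hz ⟨⟨z, h⟩, by simp⟩

open Classical in
theorem sum_edgeSet_eq_sum_dart {M : Type*} [AddCommMonoid M] {f : G.edgeSet → M} {g : G.Dart → M}
    (hfg : ∀ a, f ⟨a.edge, a.edge_mem⟩ = g a + g a.symm) : ∑ e, f e = ∑ a, g a := by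
  let edge (a : G.Dart) : G.edgeSet := ⟨a.edge, a.edge_mem⟩
  rw [← Finset.sum_fiberwise (s := .univ) (g := edge)]
  refine Finset.sum_congr rfl fun e _ => ?_
  obtain ⟨a, rfl⟩ : ∃ a : G.Dart, ⟨a.edge, a.edge_mem⟩ = e := by
    obtain ⟨⟨x, y⟩, h⟩ := e
    exact ⟨⟨(x, y), h⟩, rfl⟩
  simp only [edge, Subtype.mk.injEq, a.edge_fiber, Finset.sum_pair a.symm_ne.symm, hfg]

variable {ι : Type*} [Fintype ι]

open Classical in
theorem dotProduct_rigidityMap (p p' : V → ι → R) (ω : G.edgeSet → R) :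
    ω ⬝ᵥ rigidityMap G p p' = -∑ x, netForce G p ω x ⬝ᵥ p' x := by
  let g (a : G.Dart) : R := (ω ⟨a.edge, a.edge_mem⟩ • (p a.fst - p a.snd)) ⬝ᵥ p' a.fst
  have hg (x : V) : ∑ y, (if h : G.Adj x y then g ⟨(x, y), h⟩ else 0) =
      -(netForce G p ω x ⬝ᵥ p' x) := by
    rw [← neg_dotProduct, netForce, ← Finset.sum_neg_distrib, sum_dotProduct]
    refine Finset.sum_congr rfl fun y _ => ?_
    split_ifs
    · rw [← smul_neg, neg_sub]
      rfl
    · simp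
  rw [← Finset.sum_neg_distrib, ← Finset.sum_congr rfl fun x _ => hg x, ← sum_dart]
  refine sum_edgeSet_eq_sum_dart fun a => ?_
  have hsymm : (⟨a.symm.edge, a.symm.edge_mem⟩ : G.edgeSet) = ⟨a.edge, a.edge_mem⟩ :=
    Subtype.ext a.edge_symm
  simp only [g, hsymm]
  obtain ⟨⟨x, y⟩, h⟩ := a
  simp [SimpleGraph.Dart.edge]
  ring

end Stresses

section StressSpace

variable {V W : Type*} [Fintype V] [AddCommGroup W] [Module ℂ W] {G H : SimpleGraph V} {d : ℕ}
  {p q : V → Fin d → ℂ}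

theorem mem_stressSpace_iff_netForce {p : V → W} {ω : G.edgeSet → ℂ} :
    ω ∈ stressSpace G p ↔ ∀ x, netForce G p ω x = 0 :=
  Iff.rfl

theorem mem_stressSpace_iff_forall_coord {ω : G.edgeSet → ℂ} :
    ω ∈ stressSpace G p ↔ ∀ i, ω ∈ stressSpace G fun x => p x i := by
  simp only [mem_stressSpace_iff_netForce, funext_iff, netForce_apply, Pi.zero_apply]
  exact forall_comm

open Classical in
theorem mem_stressSpace_iff_dotProduct_rigidityMap {ω : G.edgeSet → ℂ} :
    ω ∈ stressSpace G p ↔ ∀ p', ω ⬝ᵥ rigidityMap G p p' = 0 := by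
  simp only [mem_stressSpace_iff_netForce, dotProduct_rigidityMap, neg_eq_zero]
  refine ⟨fun h p' => by simp [h], fun h x => dotProduct_eq_zero _ fun v => ?_⟩
  have hxv := h (Pi.single x v)
  rwa [Fintype.sum_eq_single x fun y hy => by simp [hy], Pi.single_eq_same] at hxv

theorem stressSpace_le_of_equivalent (hp : IsGeneric p) (hpq : Equivalent G p q) :
    stressSpace G p ≤ stressSpace G q := fun ω hω => by
  classical
  rw [mem_stressSpace_iff_dotProduct_rigidityMap] at hω ⊢
  intro q'
  obtain ⟨p', hp'⟩ := hp.range_rigidityMap_le hpq ⟨q', rfl⟩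
  rw [← hp', hω]

theorem extend_mem_stressSpace_iff (hGH : G ≤ H) {p : V → W} {ω : G.edgeSet → ℂ} :
    Function.extend (Set.inclusion (SimpleGraph.edgeSet_mono hGH)) ω 0 ∈ stressSpace H p ↔
      ω ∈ stressSpace G p := by
  simp only [mem_stressSpace_iff_netForce, netForce_extend hGH]

theorem sharedStressKernel_anti (p : V → Fin d → ℂ) :
    Antitone fun G : SimpleGraph V => sharedStressKernel G p := fun _ _ hGH _ hq _ hω =>
  (extend_mem_stressSpace_iff hGH).1 (hq ((extend_mem_stressSpace_iff hGH).2 hω))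

theorem exists_mem_stressSpace_ne_zero {e : G.edgeSet}
    (he : ∀ p', (∀ a ≠ e, edgeForm p p' a = 0) → edgeForm p p' e = 0) :
    ∃ ω ∈ stressSpace G p, ω e ≠ 0 := by
  classical
  have hsingle : Pi.single e 1 ∉ LinearMap.range (rigidityMap G p) := by
    rintro ⟨p', hp'⟩
    have h0 : edgeForm p p' e = 0 := he p' fun a ha => by
      rw [← rigidityMap_apply, hp', Pi.single_eq_of_ne ha]
    rw [← rigidityMap_apply, hp', Pi.single_eq_same] at h0
    exact one_ne_zero h0
  obtain ⟨f, hfe, hf⟩ := Submodule.exists_le_ker_of_notMem hsingle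
  refine ⟨(dotProductEquiv ℂ G.edgeSet).symm f, ?_, by simpa using hfe⟩
  refine mem_stressSpace_iff_dotProduct_rigidityMap.2 fun p' => ?_
  exact (LinearMap.congr_fun ((dotProductEquiv ℂ G.edgeSet).apply_symm_apply f) _).trans
    (hf ⟨p', rfl⟩)

end StressSpace

section AlgebraicMatroid

theorem zariskiClosure_eq_univ_iff {σ : Type*} {Y : Set (σ → ℂ)} :
    zariskiClosure Y = Set.univ ↔ vanishingIdeal ℂ Y = ⊥ := by
  refine ⟨fun h => eq_bot_iff.2 fun f hf => MvPolynomial.funext fun x => ?_, fun h => ?_⟩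
  · have hx : x ∈ zariskiClosure Y := h ▸ Set.mem_univ x
    simpa using hx f hf
  · rw [zariskiClosure, h, zeroLocus_bot, Set.top_eq_univ]

theorem algMatroidIndep_iff {E : Type*} {X : Set (E → ℂ)} {E₀ : Set E} :
    AlgMatroidIndep X E₀ ↔ ∀ f : MvPolynomial E₀ ℂ, rename (↑) f ∈ vanishingIdeal ℂ X → f = 0 := by
  rw [AlgMatroidIndep, zariskiClosure_eq_univ_iff, Submodule.eq_bot_iff]
  simp only [mem_vanishingIdeal_iff, Set.forall_mem_image, aeval_rename]
  rfl

theorem algMatroidIndep_zariskiClosure {E : Type*} {X : Set (E → ℂ)} {E₀ : Set E} :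
    AlgMatroidIndep (zariskiClosure X) E₀ ↔ AlgMatroidIndep X E₀ := by
  have hideal : vanishingIdeal ℂ (zariskiClosure X) = vanishingIdeal ℂ X :=
    (vanishingIdeal_anti_mono (zeroLocus_vanishingIdeal_le X)).antisymm
      (le_vanishingIdeal_zeroLocus _)
  rw [algMatroidIndep_iff, algMatroidIndep_iff, hideal]

theorem algMatroidIndep_range_aeval {E σ : Type*} (g : E → MvPolynomial σ ℂ) (E₀ : Set E) :
    AlgMatroidIndep (Set.range fun (x : σ → ℂ) e => aeval x (g e)) E₀ ↔
      AlgebraicIndepOn ℂ g E₀ := by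
  have haeval (x : σ → ℂ) (f : MvPolynomial E₀ ℂ) :
      aeval (fun e => aeval x (g e)) (rename (↑) f) = aeval x (aeval (fun e : E₀ => g e) f) := by
    rw [aeval_rename]
    exact (comp_aeval_apply (fun e : E₀ => g e) (aeval x) f).symm
  have hzero (h : MvPolynomial σ ℂ) : h = 0 ↔ ∀ x : σ → ℂ, aeval x h = 0 := by
    simpa using MvPolynomial.funext_iff (p := h) (q := 0)
  simp only [algMatroidIndep_iff, AlgebraicIndepOn, algebraicIndependent_iff,
    mem_vanishingIdeal_iff, Set.forall_mem_range, haeval, hzero (aeval _ _)]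

theorem algebraicIndependent_map_iff {ι σ K L : Type*} [Field K] [Field L] [Algebra K L]
    {x : ι → MvPolynomial σ K} :
    AlgebraicIndependent L (fun i => map (algebraMap K L) (x i)) ↔ AlgebraicIndependent K x := by
  refine ⟨fun h => .of_ringHom_of_comp_eq (algebraMap K L) (map (algebraMap K L)) h
    (algebraMap K L).injective (by ext; simp), fun h => ?_⟩
  let f : MvPolynomial ι K →ₐ[K] MvPolynomial σ K := aeval x
  have hf : Function.Injective (Algebra.TensorProduct.map (AlgHom.id L L) f) :=
    Module.Flat.lTensor_preserves_injective_linearMap (M := L) f.toLinearMap h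
  have hbaseChange : (aeval fun i => map (algebraMap K L) (x i)) =
      ((algebraTensorAlgEquiv K L).toAlgHom.comp
        (Algebra.TensorProduct.map (AlgHom.id L L) f)).comp
        (algebraTensorAlgEquiv K L).symm.toAlgHom := by
    ext1 i
    simp [f]
  rw [algebraicIndependent_iff_injective_aeval, hbaseChange]
  exact ((algebraTensorAlgEquiv K L).injective.comp hf).comp
    (algebraTensorAlgEquiv K L).symm.injective

theorem natCast_algMatroidRank {α : Type*} {M : Matroid α} {s : Set α} (hs : s.Finite)
    {X : Set (s → ℂ)} (hX : ∀ E₀, AlgMatroidIndep X E₀ ↔ M.Indep ((↑) '' E₀)) :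
    (algMatroidRank X : ℕ∞) = M.eRk s := by
  obtain ⟨I, hI⟩ := M.exists_isBasis' s
  have hImage : ((↑) '' ((↑) ⁻¹' I : Set s) : Set α) = I := by
    rw [Subtype.image_preimage_coe, Set.inter_eq_right.2 hI.subset]
  have := hs.to_subtype
  have hncard (E₀ : Set s) : (E₀.ncard : ℕ∞) = ((↑) '' E₀ : Set α).encard := by
    rw [Subtype.val_injective.encard_image, E₀.toFinite.cast_ncard_eq]
  have hmax : IsGreatest {k | ∃ E₀, AlgMatroidIndep X E₀ ∧ E₀.ncard = k}
      ((↑) ⁻¹' I : Set s).ncard := by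
    refine ⟨⟨_, (hX _).2 (hImage.symm ▸ hI.indep), rfl⟩, ?_⟩
    rintro _ ⟨E₀, hE₀, rfl⟩
    rw [← Nat.cast_le (α := ℕ∞), hncard, hncard, hImage, hI.encard_eq_eRk]
    exact ((hX E₀).1 hE₀).encard_le_eRk_of_subset (Subtype.coe_image_subset s E₀)
  rw [algMatroidRank, hmax.csSup_eq, hncard, hImage, hI.encard_eq_eRk]

end AlgebraicMatroid

section LengthMatroid

variable {V : Type*} {d : ℕ}

/-- The matroid on all vertex pairs given by algebraic independence over `ℚ` of the squared
lengths in `p`; for generic `p` it restricts to the algebraic matroid of `M_{d,G}` on the edges of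
any graph `G`. -/
noncomputable def lengthMatroid (p : V → Fin d → ℂ) : Matroid (Sym2 V) :=
  (AlgebraicIndependent.matroid ℚ ℂ).comap (edgeForm p p)

theorem lengthMatroid_indep_iff {p : V → Fin d → ℂ} {s : Set (Sym2 V)} :
    (lengthMatroid p).Indep s ↔ AlgebraicIndepOn ℚ (edgeForm p p) s := by
  rw [lengthMatroid, Matroid.comap_indep_iff, AlgebraicIndependent.matroid_indep_iff]
  exact ⟨fun h => (algebraicIndependent_image h.2).2 h.1, fun h =>
    have hinj := Set.injOn_iff_injective.2 h.injective
    ⟨(algebraicIndependent_image hinj).1 h, hinj⟩⟩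

theorem mem_closure_lengthMatroid {p : V → Fin d → ℂ} {s : Set (Sym2 V)} {e : Sym2 V} :
    e ∈ (lengthMatroid p).closure s ↔
      IsAlgebraic (Algebra.adjoin ℚ (edgeForm p p '' s)) (edgeForm p p e) := by
  rw [lengthMatroid, Matroid.comap_closure_eq, AlgebraicIndependent.matroid_closure_eq]
  rfl

theorem measurementVariety_eq_zariskiClosure (G : SimpleGraph V) :
    measurementVariety d G = zariskiClosure
      (Set.range fun (x : V × Fin d → ℂ) (e : G.edgeSet) => aeval x (lengthPolynomial ℂ e.1)) := by
  rw [measurementVariety, ← (Equiv.curry V (Fin d) ℂ).surjective.range_comp]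
  congr! with x e
  rw [Function.comp_apply, measurementMap_eq_rigidityMap]
  exact (aeval_lengthPolynomial (R := ℂ) (Equiv.curry V (Fin d) ℂ x) e).symm

theorem IsGeneric.algebraicIndependent_edgeForm_iff {K σ : Type*} [Field K] [CharZero K]
    {p : V → Fin d → K} (hp : IsGeneric p) (e : σ → Sym2 V) :
    AlgebraicIndependent ℚ (fun i => edgeForm p p (e i)) ↔
      AlgebraicIndependent ℚ fun i => lengthPolynomial (ι := Fin d) ℚ (e i) := by
  rw [← AlgHom.algebraicIndependent_iff (aeval fun z : V × Fin d => p z.1 z.2) hp]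
  simp only [Function.comp_def, aeval_lengthPolynomial]

theorem IsGeneric.algMatroidIndep_measurementVariety_iff {G : SimpleGraph V} {p : V → Fin d → ℂ}
    (hp : IsGeneric p) (E₀ : Set G.edgeSet) :
    AlgMatroidIndep (measurementVariety d G) E₀ ↔ (lengthMatroid p).Indep ((↑) '' E₀) := by
  rw [measurementVariety_eq_zariskiClosure, algMatroidIndep_zariskiClosure,
    algMatroidIndep_range_aeval, lengthMatroid_indep_iff, AlgebraicIndepOn, AlgebraicIndepOn,
    ← algebraicIndependent_equiv (Equiv.Set.image _ E₀ Subtype.val_injective)]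
  refine Iff.trans ?_ (hp.algebraicIndependent_edgeForm_iff fun e : E₀ => (e : Sym2 V)).symm
  simp only [← algebraicIndependent_map_iff (K := ℚ) (L := ℂ), map_lengthPolynomial]

theorem IsGeneric.natCast_rigidityRank [Finite V] (G : SimpleGraph V) {p : V → Fin d → ℂ}
    (hp : IsGeneric p) : (rigidityRank d G : ℕ∞) = (lengthMatroid p).eRk G.edgeSet :=
  natCast_algMatroidRank G.edgeSet.toFinite hp.algMatroidIndep_measurementVariety_iff

theorem edgeSet_addEdge (G : SimpleGraph V) {u v : V} (huv : u ≠ v) :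
    (addEdge G u v).edgeSet = insert s(u, v) G.edgeSet := by
  rw [addEdge, SimpleGraph.edgeSet_sup, SimpleGraph.edgeSet_edge_of_ne huv, Set.union_singleton]

theorem RigidityLinked.isAlgebraic [Finite V] {G : SimpleGraph V} {u v : V}
    (h : RigidityLinked d G u v) (huv : u ≠ v) {p : V → Fin d → ℂ} (hp : IsGeneric p) :
    IsAlgebraic (Algebra.adjoin ℚ (edgeForm p p '' G.edgeSet)) (edgeForm p p s(u, v)) := by
  rw [← mem_closure_lengthMatroid]
  by_contra hcl
  have hrank := (lengthMatroid p).eRk_insert_eq_add_one ⟨Set.mem_univ _, hcl⟩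
  rw [← edgeSet_addEdge G huv, ← hp.natCast_rigidityRank, ← hp.natCast_rigidityRank, h] at hrank
  norm_cast at hrank
  omega

end LengthMatroid

section Conjugation

open Cardinal in
/-- The part of the basis outside `x` has the cardinality of `L` whatever `x` is, so indexing it by
`L` matches the bases that extend two different families. -/
theorem exists_isTranscendenceBasis_sum_inl_eq {F L ι : Type*} [Field F] [Countable F]
    [Field L] [IsAlgClosed L] [Uncountable L] [Algebra F L] [Finite ι] {x : ι → L}
    (hx : AlgebraicIndependent F x) :
    ∃ b : ι ⊕ L → L, IsTranscendenceBasis F b ∧ ∀ i, b (Sum.inl i) = x i := by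
  obtain ⟨s, hxs, hs⟩ := exists_isTranscendenceBasis_superset hx.to_subtype_range
  have huncountable : ℵ₀ < #L := aleph0_lt_mk_iff.2 inferInstance
  have hcard : #L = #s := lift_injective <|
    IsAlgClosed.cardinal_eq_cardinal_transcendence_basis_of_aleph0_lt _ hs mk_le_aleph0 huncountable
  have hsplit : #(Set.range x) + #(s \ Set.range x : Set L) = #s := by
    rw [add_comm, mk_sdiff_add_mk hxs]
  have hdiff : #(s \ Set.range x : Set L) = #L := hcard ▸ eq_of_add_eq_of_aleph0_le hsplit
    ((lt_aleph0_of_finite _).trans (hcard ▸ huncountable)) (hcard ▸ huncountable).le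
  obtain ⟨f⟩ := Cardinal.eq.1 hdiff
  classical
  let κ : ι ⊕ L ≃ s := ((Equiv.ofInjective x hx.injective).sumCongr f.symm).trans
    (Equiv.Set.sumDiffSubset hxs)
  exact ⟨fun j => κ j, (isTranscendenceBasis_equiv' κ rfl).2 hs, fun i => rfl⟩

theorem exists_ringEquiv_of_isTranscendenceBasis {R κ L M : Type*} [CommRing R]
    [Field L] [Field M] [Algebra R L] [Algebra R M] [IsAlgClosed L] [IsAlgClosed M]
    {b : κ → L} {c : κ → M} (hb : IsTranscendenceBasis R b) (hc : IsTranscendenceBasis R c) :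
    ∃ σ : L ≃+* M, ∀ j, σ (b j) = c j := by
  have := IsAlgClosed.isAlgClosure_of_transcendence_basis b hb
  have := IsAlgClosed.isAlgClosure_of_transcendence_basis c hc
  let e := (hb.1.aevalEquiv.symm.trans hc.1.aevalEquiv).toRingEquiv
  refine ⟨IsAlgClosure.equivOfEquiv L M e, fun j => ?_⟩
  simpa [e] using IsAlgClosure.equivOfEquiv_algebraMap L M e (hb.1.aevalEquiv (X j))

theorem exists_ringEquiv_of_algebraicIndependent {F L ι : Type*} [Field F] [Countable F]
    [Field L] [IsAlgClosed L] [Uncountable L] [Algebra F L] [Finite ι] {x y : ι → L}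
    (hx : AlgebraicIndependent F x) (hy : AlgebraicIndependent F y) :
    ∃ σ : L ≃+* L, ∀ i, σ (x i) = y i := by
  obtain ⟨b, hb, hbx⟩ := exists_isTranscendenceBasis_sum_inl_eq hx
  obtain ⟨c, hc, hcy⟩ := exists_isTranscendenceBasis_sum_inl_eq hy
  obtain ⟨σ, hσ⟩ := exists_ringEquiv_of_isTranscendenceBasis hb hc
  exact ⟨σ, fun i => by rw [← hbx, hσ, hcy]⟩

theorem IsGeneric.exists_ringEquiv {V : Type*} [Finite V] {d : ℕ} {p p' : V → Fin d → ℂ}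
    (hp : IsGeneric p) (hp' : IsGeneric p') : ∃ σ : ℂ ≃+* ℂ, (fun x => σ ∘ p x) = p' := by
  have : Uncountable ℂ := Cardinal.aleph0_lt_mk_iff.1 <| by
    rw [Cardinal.mk_complex]; exact Cardinal.aleph0_lt_continuum
  obtain ⟨σ, hσ⟩ := exists_ringEquiv_of_algebraicIndependent hp hp'
  exact ⟨σ, funext₂ fun x i => hσ (x, i)⟩

end Conjugation

section SharedStressNullity

variable {V : Type*} [Fintype V] {G : SimpleGraph V} {d : ℕ}

theorem comp_mem_stressSpace_iff (σ : ℂ →+* ℂ) {q : V → ℂ} {ω : G.edgeSet → ℂ} :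
    σ ∘ ω ∈ stressSpace G (σ ∘ q) ↔ ω ∈ stressSpace G q := by
  simp only [mem_stressSpace_iff_netForce, ← map_netForce, map_eq_zero]

theorem comp_mem_stressSpace_pi_iff (σ : ℂ →+* ℂ) {p : V → Fin d → ℂ} {ω : G.edgeSet → ℂ} :
    σ ∘ ω ∈ stressSpace G (fun x => σ ∘ p x) ↔ ω ∈ stressSpace G p := by
  rw [mem_stressSpace_iff_forall_coord, mem_stressSpace_iff_forall_coord]
  exact forall_congr' fun i => comp_mem_stressSpace_iff σ (q := fun x => p x i)

theorem comp_mem_sharedStressKernel_iff (σ : ℂ ≃+* ℂ) {p : V → Fin d → ℂ} {q : V → ℂ} :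
    σ ∘ q ∈ sharedStressKernel G (fun x => σ ∘ p x) ↔ q ∈ sharedStressKernel G p :=
  σ.surjective.comp_left.forall.trans <| forall_congr' fun _ =>
    imp_congr (comp_mem_stressSpace_pi_iff σ.toRingHom) (comp_mem_stressSpace_iff σ.toRingHom)

theorem IsGeneric.finrank_sharedStressKernel_eq (G : SimpleGraph V) {p p' : V → Fin d → ℂ}
    (hp : IsGeneric p) (hp' : IsGeneric p') :
    Module.finrank ℂ (sharedStressKernel G p) = Module.finrank ℂ (sharedStressKernel G p') := by
  obtain ⟨σ, rfl⟩ := hp.exists_ringEquiv hp'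
  let j : sharedStressKernel G p ≃+ sharedStressKernel G fun x => σ ∘ p x :=
    { (Equiv.arrowCongr (.refl V) σ.toEquiv).subtypeEquiv fun _ =>
        (comp_mem_sharedStressKernel_iff σ).symm with
      map_add' := fun a b => Subtype.ext (funext fun x => map_add σ (a.1 x) (b.1 x)) }
  rw [Module.finrank, Module.finrank, rank_eq_of_equiv_equiv σ j σ.bijective
    fun c q => Subtype.ext (funext fun x => map_mul σ c (q.1 x))]

theorem IsGeneric.sharedStressNullity_eq (G : SimpleGraph V) {p : V → Fin d → ℂ}
    (hp : IsGeneric p) :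
    sharedStressNullity d G = Module.finrank ℂ (sharedStressKernel G p) := by
  have hset : {k | ∃ p : V → Fin d → ℂ, IsGeneric p ∧
      Module.finrank ℂ (sharedStressKernel G p) = k} =
        {Module.finrank ℂ (sharedStressKernel G p)} :=
    Set.eq_singleton_iff_unique_mem.2 ⟨⟨p, hp, rfl⟩, by
      rintro _ ⟨p', hp', rfl⟩
      exact hp'.finrank_sharedStressKernel_eq G hp⟩
  rw [sharedStressNullity, hset, csInf_singleton]

end SharedStressNullity

section GlobalLinkedness

theorem GloballyLinked.of_ringHom {V K L : Type*} [Field K] [CharZero K] [Field L] [CharZero L]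
    {d : ℕ} {G : SimpleGraph V} {u v : V} (φ : K →+* L) (h : GloballyLinked L d G u v) :
    GloballyLinked K d G u v := by
  intro p q hp hpq
  have hφp : IsGeneric fun x i => φ (p x i) :=
    AlgebraicIndependent.map' (f := φ.toRatAlgHom) hp φ.injective
  have hφpq : Equivalent G (fun x i => φ (p x i)) fun x i => φ (q x i) :=
    equivalent_iff.2 fun e he => by
      simpa only [map_edgeForm] using congrArg φ (equivalent_iff.1 hpq e he)
  have huv := h _ _ hφp hφpq
  rw [sqDist_eq_edgeForm, sqDist_eq_edgeForm, ← map_edgeForm, ← map_edgeForm] at huv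
  rw [sqDist_eq_edgeForm, sqDist_eq_edgeForm, φ.injective huv]

variable {V : Type*} [Fintype V] {G H : SimpleGraph V} {d : ℕ} {u v : V} {p q : V → Fin d → ℂ}

theorem RigidityLinked.exists_mem_stressSpace_ne_zero (h : RigidityLinked d G u v)
    (hG : ¬G.Adj u v) (huv : (addEdge G u v).Adj u v) (hp : IsGeneric p) :
    ∃ ω ∈ stressSpace (addEdge G u v) p, ω ⟨s(u, v), huv⟩ ≠ 0 :=
  StressLinked.exists_mem_stressSpace_ne_zero fun _ hp' =>
    hp.edgeForm_eq_zero_of_isAlgebraic (h.isAlgebraic huv.ne hp) fun a ha =>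
      hp' ⟨a, SimpleGraph.edgeSet_mono le_sup_left ha⟩ fun hae =>
        hG (G.mem_edgeSet.1 (Subtype.mk.inj hae ▸ ha))

theorem IsStressLinked.sharedStressKernel_addEdge (h : IsStressLinked d G u v) (hp : IsGeneric p) :
    sharedStressKernel (addEdge G u v) p = sharedStressKernel G p := by
  refine Submodule.eq_of_le_of_finrank_eq (sharedStressKernel_anti p le_sup_left) ?_
  rw [← hp.sharedStressNullity_eq, ← hp.sharedStressNullity_eq, h.2]

theorem IsStressLinked.stressSpace_addEdge_le (h : IsStressLinked d G u v) (hp : IsGeneric p)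
    (hpq : Equivalent G p q) : stressSpace (addEdge G u v) p ≤ stressSpace (addEdge G u v) q := by
  refine fun ω hω => mem_stressSpace_iff_forall_coord.2 fun i => ?_
  have hqi : (fun x => q x i) ∈ sharedStressKernel G p := fun _ hω' =>
    mem_stressSpace_iff_forall_coord.1 (stressSpace_le_of_equivalent hp hpq hω') i
  rw [← h.sharedStressKernel_addEdge hp] at hqi
  exact hqi hω

theorem edgeForm_eq_of_mem_stressSpace {e : H.edgeSet} {ω : H.edgeSet → ℂ}
    (hp : ω ∈ stressSpace H p) (hq : ω ∈ stressSpace H q) (he : ω e ≠ 0)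
    (hpq : ∀ a : H.edgeSet, a ≠ e → edgeForm p p a = edgeForm q q a) :
    edgeForm p p e = edgeForm q q e := by
  classical
  rw [mem_stressSpace_iff_dotProduct_rigidityMap] at hp hq
  have h0 : ω ⬝ᵥ (rigidityMap H p p - rigidityMap H q q) = 0 := by
    rw [dotProduct_sub, hp, hq, sub_zero]
  rw [dotProduct, Fintype.sum_eq_single e fun a ha => by simp [hpq a ha]] at h0
  exact sub_eq_zero.1 ((mul_eq_zero.1 h0).resolve_left he)

theorem IsStressLinked.globallyLinked_complex (h : IsStressLinked d G u v) :
    GloballyLinked ℂ d G u v := by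
  intro p q hp hpq
  rw [sqDist_eq_edgeForm, sqDist_eq_edgeForm]
  obtain rfl | huv := eq_or_ne u v
  · simp
  by_cases hG : G.Adj u v
  · exact equivalent_iff.1 hpq _ hG
  have hadj : (addEdge G u v).Adj u v := by
    rw [← SimpleGraph.mem_edgeSet, edgeSet_addEdge G huv]
    exact Set.mem_insert _ _
  obtain ⟨ω, hωp, hω⟩ := h.1.exists_mem_stressSpace_ne_zero hG hadj hp
  refine edgeForm_eq_of_mem_stressSpace hωp (h.stressSpace_addEdge_le hp hpq hωp) hω fun a ha => ?_
  have haG := (edgeSet_addEdge G huv).subset a.2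
  exact equivalent_iff.1 hpq a (haG.resolve_left fun hae => ha (Subtype.ext hae))

end GlobalLinkedness

end StressLinked

theorem mainTheorem1 {V : Type*} [Fintype V] (d : ℕ) (G : SimpleGraph V) (u v : V)
    (h : StressLinked.IsStressLinked d G u v) :
    StressLinked.GloballyLinked ℂ d G u v ∧ StressLinked.GloballyLinked ℝ d G u v :=
  ⟨h.globallyLinked_complex, h.globallyLinked_complex.of_ringHom Complex.ofRealHom⟩
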